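/- **Setting.** Let $K\ge1$, $T\ge2$, $1\le\Upsilon\le T$, $\epsilon\in(0,1]$, $v>0$. Consider a heavy-tailed piecewise-stationary bandit with $K$ arms, horizon $T$ and breakpoints $0=t_c^{(0)}<t_c^{(1)}<\dots<t_c^{(\Upsilon)}\le t_c^{(\Upsilon+1)}=T$: in every epoch $E_j=\{t_c^{(j-1)}+1,\dots,t_c^{(j)}\}$, $1\le j\le\Upsilon+1$, the rewards of arm $i$ have a fixed distribution $\nu_i^{(j)}$ with mean $\mu_i^{(j)}$ and $\mathbb{E}|X-\mu_i^{(j)}|^{1+\epsilon}\le v$. Let $\Delta_{max}^{(j)}=\max_i(\max_k\mu_k^{(j)}-\mu_i^{(j)})$ and $\Delta_{max}=\max_j\Delta_{max}^{(j)}$; let $\delta_{min}^{(j)}=\min_i|\mu_i^{(j+1)}-\mu_i^{(j)}|$ for $1\le j\le\Upsilon$, $\delta_{min}^{(0)}=\infty$, $\widetilde\delta_{min}^{(j)}=\min\{\delta_{min}^{(j-1)},\delta_{min}^{(j)}\}$, and assume $\delta_{min}=\min_{1\le j\le\Upsilon}\delta_{min}^{(j)}>0$. **Policy.** R-CPD-UCB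 with exploration parameter $\eta$ plays, in each block of $\lfloor K/\eta\rfloor$ rounds since its last restart, every arm once; in the other rounds it follows an inner policy $\pi_s$ fed with the history since the last restart; and it restarts as soon as two Catoni confidence sequences (level $1-2/T^3$) of the arm just played are disjoint. Fix $\eta_0>0$, let $\eta_j=\eta_0\sqrt{jK\log(T)/T}$, and run R-CPD-UCB with $\eta_1$ at first and with $\eta_{j+1}$ after the $j$-th detection; this requires no knowledge of $\Upsilon$. Assume that the exploration periods in use, $\lfloor K/\eta_j\rfloor$ for $1\le j\le\Upsilon+1$, are at least $1$. **Claim.** The detection-delay contribution $(A)$ and the uniform-exploration contribution $(C)$ satisfy $$(A):=\sum_{j=1}^{\Upsilon}\frac{v^{1/\epsilon}\log T}{(\widetilde\delta_{min}^{(j)})^{(1+\epsilon)/\epsilon}}\Big\lceil\frac{K}{\eta_j}\Big\rceil\Delta_{max}^{(j)}\;\le\;4\,\frac{v^{1/\epsilon}\sqrt{K\Upsilon T\log T}}{\eta_0\,\delta_{min}^{(1+\epsilon)/\epsilon}}\,\Delta_{max},$$ $$(C):=\sum_{j=1}^{\Upsilon+1}\eta_j|E_j|\Delta_{max}^{(j)}\;\le\;\eta_0\sqrt{K(\Upsilon+1)T\log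 T}\,\Delta_{max}.$$ Moreover, for every inner policy, every choice of the weights in the confidence sequences and every realization of the rewards for which the policy restarts exactly $\Upsilon$ times up to round $T$, the same two bounds hold when the exploration parameters are those that the policy really uses: with $\eta_j$ in $(A)$ replaced by the parameter in force at the round of the $j$-th detection, and with $(C)$ replaced by $\sum_{t=1}^{T}\eta(t)\Delta_{max}^{(j(t))}$, where $\eta(t)$ is the parameter in force at round $t$ and $j(t)$ is the epoch that contains $t$. -/

import Mathlib

open scoped BigOperators

noncomputable section

/-! ## Heavy-tailed piecewise-stationary bandits -/

/-- A heavy-tailed piecewise-stationary bandit with `K` arms, horizon `T` and `U` breakpoints.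
The breakpoints are `tc 1 < ... < tc U` in `{1, ..., T}`, with the conventions `tc 0 = 0` and
`tc (U + 1) = T`.  The epoch `j` (for `1 ≤ j ≤ U + 1`) consists of the rounds `t` with
`tc (j - 1) < t ≤ tc j`, and `ν j i` is the reward distribution of arm `i` during it. -/
structure HTPSBandit (K T U : ℕ) (v ε : ℝ) where
  ν : ℕ → Fin K → MeasureTheory.Measure ℝ
  tc : ℕ → ℕ
  tc_zero : tc 0 = 0
  tc_last : tc (U + 1) = T
  tc_lt : ∀ j, j < U → tc j < tc (j + 1)
  tc_le : tc U ≤ T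
  isProb : ∀ j ∈ Finset.Icc 1 (U + 1), ∀ i, MeasureTheory.IsProbabilityMeasure (ν j i)
  integrable_id : ∀ j ∈ Finset.Icc 1 (U + 1), ∀ i, MeasureTheory.Integrable (fun x : ℝ => x) (ν j i)
  integrable_moment : ∀ j ∈ Finset.Icc 1 (U + 1), ∀ i,
    MeasureTheory.Integrable (fun x : ℝ => |x - ∫ y, y ∂(ν j i)| ^ (1 + ε)) (ν j i)
  moment_le : ∀ j ∈ Finset.Icc 1 (U + 1), ∀ i,
    ∫ x, |x - ∫ y, y ∂(ν j i)| ^ (1 + ε) ∂(ν j i) ≤ v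

namespace HTPSBandit

variable {K T U : ℕ} {v ε : ℝ} (B : HTPSBandit K T U v ε)

/-- Mean reward of arm `i` in epoch `j`. -/
def mean (j : ℕ) (i : Fin K) : ℝ := ∫ x, x ∂(B.ν j i)

/-- Sub-optimality gap of arm `i` in epoch `j`. -/
def gap (j : ℕ) (i : Fin K) : ℝ := |(⨆ k, B.mean j k) - B.mean j i|

/-- Largest gap in epoch `j`. -/
def gapMaxEpoch (j : ℕ) : ℝ := ⨆ i, B.gap j i

/-- Largest gap over all epochs. -/
def gapMax : ℝ := ⨆ j : Finset.Icc 1 (U + 1), B.gapMaxEpoch j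

/-- Magnitude of the change in the mean of arm `i` at the `j`-th breakpoint (`1 ≤ j ≤ U`), which
separates the epochs `j` and `j + 1`. -/
def change (j : ℕ) (i : Fin K) : ℝ := |B.mean (j + 1) i - B.mean j i|

/-- Smallest change over the arms at the `j`-th breakpoint. -/
def changeMinAt (j : ℕ) : ℝ := ⨅ i, B.change j i

/-- Smallest change over all arms and all breakpoints. -/
def changeMin : ℝ := ⨅ j : Finset.Icc 1 U, B.changeMinAt j

/-- The smaller of the minimal changes at the two ends of epoch `j`; the change before the first
epoch is infinite by convention, so it does not count. -/
def changeMinAround (j : ℕ) : ℝ :=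
  if j = 1 then B.changeMinAt 1 else min (B.changeMinAt (j - 1)) (B.changeMinAt j)

/-- Length of epoch `j`. -/
def epochLength (j : ℕ) : ℕ := B.tc j - B.tc (j - 1)

/-- Index of the epoch containing the round `t`. -/
def epochOf (t : ℕ) : ℕ := 1 + ((Finset.Icc 1 U).filter (fun j => B.tc j < t)).card

/-- The detection-delay contribution
`∑_j v^(1/ε) log T / (changeMinAround j)^((1+ε)/ε) ⌈K / η_j⌉ Δ_max^(j)`, where `η j` is the
exploration parameter in force when the `j`-th breakpoint is detected. -/
def detectionDelayTerm (η : ℕ → ℝ) : ℝ :=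
  ∑ j ∈ Finset.Icc 1 U,
    v ^ (1 / ε) * Real.log T / B.changeMinAround j ^ ((1 + ε) / ε) *
      (⌈(K : ℝ) / η j⌉ : ℝ) * B.gapMaxEpoch j

/-- The uniform-exploration contribution `∑_j η_j |E_j| Δ_max^(j)`, where `η j` is the exploration
parameter of epoch `j`. -/
def explorationTerm (η : ℕ → ℝ) : ℝ :=
  ∑ j ∈ Finset.Icc 1 (U + 1), η j * (B.epochLength j : ℝ) * B.gapMaxEpoch j

/-- The uniform-exploration contribution when the parameter may change from round to round:
`η t` is the parameter in force at round `t`. -/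
def roundwiseExplorationTerm (η : ℕ → ℝ) : ℝ :=
  ∑ t ∈ Finset.Icc 1 T, η t * B.gapMaxEpoch (B.epochOf t)

end HTPSBandit

/-- The exploration schedule `η_j = η₀ √(j K log T / T)`. -/
def etaSchedule (η₀ : ℝ) (K T : ℕ) (j : ℕ) : ℝ :=
  η₀ * Real.sqrt ((j : ℝ) * K * Real.log T / T)

/-! ## The policy R-CPD-UCB with a stage-dependent exploration parameter -/

namespace RCPDUCB

/-- The Catoni-type influence function: the odd function equal to
`log (1 + |x| + |x|^(1+ε) / (1+ε))` for `x ≥ 0`. -/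
def influence (ε x : ℝ) : ℝ :=
  SignType.sign x * Real.log (1 + |x| + |x| ^ (1 + ε) / (1 + ε))

/-- The confidence level parameter `γ = 2 / T³`. -/
def gammaLevel (T : ℕ) : ℝ := 2 / (T : ℝ) ^ 3

/-- The number of samples `68 log (T^((1+ε)/ε))` needed before detection starts. -/
def nMin (T : ℕ) (ε : ℝ) : ℝ := 68 * Real.log ((T : ℝ) ^ ((1 + ε) / ε))

/-- Catoni confidence interval from the samples `xs`; `lam n i` is the weight of the `i`-th sample
(counted from `0`) in an interval built from `n` samples. -/
def catoniCI (T : ℕ) (v ε : ℝ) (lam : ℕ → ℕ → ℝ) (xs : List ℝ) : Set ℝ :=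
  {m | |∑ i : Fin xs.length, influence ε (lam xs.length i * (xs.get i - m))| ≤
      v / (1 + ε) * (∑ i : Fin xs.length, lam xs.length i ^ (1 + ε))
        + Real.log (2 / gammaLevel T)}

/-- The confidence sequence started at the `a`-th sample (counted from `1`) of `xs`, after all of
`xs` has been observed: the values in all of its intervals so far. -/
def catoniCS (T : ℕ) (v ε : ℝ) (lam : ℕ → ℕ → ℝ) (xs : List ℝ) (a : ℕ) : Set ℝ :=
  {m | ∀ n ∈ Finset.Icc a xs.length, m ∈ catoniCI T v ε lam ((xs.take n).drop (a - 1))}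

/-- Detection test on the samples `xs` that one arm has produced since the last restart: a
confidence sequence is started at every sample from the `nMin`-th on, and a change is detected when
two of them are disjoint. -/
def detects (T : ℕ) (v ε : ℝ) (lam : ℕ → ℕ → ℝ) (xs : List ℝ) : Prop :=
  ∃ a ∈ Finset.Icc 1 xs.length, ∃ b ∈ Finset.Icc 1 xs.length,
    nMin T ε ≤ a ∧ nMin T ε ≤ b ∧ catoniCS T v ε lam xs a ∩ catoniCS T v ε lam xs b = ∅

/-- Memory of the policy: the number of detections so far, and the actions and rewards since the
last restart in chronological order. -/
structure State (K : ℕ) where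
  detections : ℕ
  history : List (Fin K × ℝ)

/-- The samples of arm `i` in a history. -/
def samplesOf {K : ℕ} (h : List (Fin K × ℝ)) (i : Fin K) : List ℝ :=
  (h.filter (fun p => p.1 = i)).map Prod.snd

/-- The action at round `t`.  In every block of `⌊K / η⌋` rounds after a restart each arm is played
once; in the other rounds the inner policy `πs` decides.  After `d` detections `η` is `η_{d+1}`. -/
def action {K : ℕ} (η : ℕ → ℝ) (πs : ℕ → List (Fin K × ℝ) → Fin K) (t : ℕ) (s : State K) : Fin K :=
  if h : s.history.length % ⌊(K : ℝ) / η (s.detections + 1)⌋₊ < K then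
    ⟨s.history.length % ⌊(K : ℝ) / η (s.detections + 1)⌋₊, h⟩
  else πs t s.history

open Classical in
/-- One round: play, observe, and restart if a change is detected on the arm that was played.
`X t i` is the reward of arm `i` at round `t`. -/
def step {K : ℕ} (T : ℕ) (v ε : ℝ) (lam : ℕ → ℕ → ℝ) (η : ℕ → ℝ)
    (πs : ℕ → List (Fin K × ℝ) → Fin K) (X : ℕ → Fin K → ℝ) (t : ℕ) (s : State K) : State K :=
  let i := action η πs t s
  let h := s.history ++ [(i, X t i)]
  if detects T v ε lam (samplesOf h i) then ⟨s.detections + 1, []⟩ else ⟨s.detections, h⟩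

/-- The state after `t` rounds, for one realization `X` of the rewards and one realization `πs` of
the inner policy, which may be randomized. The policy has access neither to the number of
breakpoints nor to their positions. -/
def run {K : ℕ} (T : ℕ) (v ε : ℝ) (lam : ℕ → ℕ → ℝ) (η : ℕ → ℝ)
    (πs : ℕ → List (Fin K × ℝ) → Fin K) (X : ℕ → Fin K → ℝ) : ℕ → State K
  | 0 => ⟨0, []⟩
  | t + 1 => step T v ε lam η πs X (t + 1) (run T v ε lam η πs X t)

/-- The exploration parameter in force at round `t ≥ 1`. -/
def etaAt {K : ℕ} (T : ℕ) (v ε : ℝ) (lam : ℕ → ℕ → ℝ) (η : ℕ → ℝ)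
    (πs : ℕ → List (Fin K × ℝ) → Fin K) (X : ℕ → Fin K → ℝ) (t : ℕ) : ℝ :=
  η ((run T v ε lam η πs X (t - 1)).detections + 1)

/-- The round of the `j`-th detection. -/
def detectionTime {K : ℕ} (T : ℕ) (v ε : ℝ) (lam : ℕ → ℕ → ℝ) (η : ℕ → ℝ)
    (πs : ℕ → List (Fin K × ℝ) → Fin K) (X : ℕ → Fin K → ℝ) (j : ℕ) : ℕ :=
  sInf {t | j ≤ (run T v ε lam η πs X t).detections}

end RCPDUCB

end

/-! The schedule satisfies `η_j = η_1 √j`. For (A), a period of at least 1 gives `⌈K/η_j⌉ ≤ 2K/η_j`,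
so the sum is at most a constant times `∑ 1/√j ≤ 2√U`. The two factors 2 make the 4, and `log T ·
K/η_1 = √(K T log T)/η₀` gives the rate. For (C), the schedule is increasing, so each parameter is
at most `η_{U+1}`, and the epoch lengths add up to `T`. On a run with exactly `U` detections, the
parameter at the `j`-th detection is `η_j` itself, wherever that detection falls, and no round uses
more than `η_{U+1}`. The same two estimates therefore apply. -/

theorem sum_inv_sqrt_le (n : ℕ) :
    ∑ j ∈ Finset.Icc 1 n, (Real.sqrt (j : ℝ))⁻¹ ≤ 2 * Real.sqrt n := by
  induction n with
  | zero => simp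
  | succ n ih =>
    rw [Finset.sum_Icc_succ_top (by omega)]
    have hpos : 0 < Real.sqrt ((n + 1 : ℕ) : ℝ) := Real.sqrt_pos.2 (by positivity)
    have hn := Real.sqrt_nonneg (n : ℝ)
    have h1 : Real.sqrt ((n + 1 : ℕ) : ℝ) ^ 2 = n + 1 := by
      rw [Real.sq_sqrt (by positivity)]; push_cast; ring
    have h2 : Real.sqrt (n : ℝ) ^ 2 = n := Real.sq_sqrt (by positivity)
    -- With `s = √(n+1)` and `r = √n`, the claim is `1 ≤ 2s² - 2sr`; as `s² - r² = 1`, this says `(s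
    -- - r)² ≥ 0`.
    have key : (Real.sqrt ((n + 1 : ℕ) : ℝ))⁻¹ ≤
        2 * Real.sqrt ((n + 1 : ℕ) : ℝ) - 2 * Real.sqrt n := by
      rw [inv_le_iff_one_le_mul₀ hpos]
      nlinarith [sq_nonneg (Real.sqrt ((n + 1 : ℕ) : ℝ) - Real.sqrt n)]
    linarith

/-! ### The exploration schedule -/

theorem etaSchedule_eq (η₀ : ℝ) (K T j : ℕ) :
    etaSchedule η₀ K T j = etaSchedule η₀ K T 1 * Real.sqrt j := by
  have h : (j : ℝ) * K * Real.log T / T = ((1 : ℕ) : ℝ) * K * Real.log T / T * j := by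
    push_cast; ring
  rw [etaSchedule, etaSchedule, h, Real.sqrt_mul' _ (Nat.cast_nonneg j), mul_assoc η₀]

theorem etaSchedule_pos {η₀ : ℝ} {K T j : ℕ} (hη₀ : 0 < η₀) (hK : 1 ≤ K) (hT : 2 ≤ T)
    (hj : 1 ≤ j) : 0 < etaSchedule η₀ K T j := by
  have hlog : 0 < Real.log T := Real.log_pos (by exact_mod_cast hT)
  have hK' : (0 : ℝ) < K := by exact_mod_cast hK
  have hT' : (0 : ℝ) < T := by positivity
  have hj' : (0 : ℝ) < j := by exact_mod_cast hj
  exact mul_pos hη₀ (Real.sqrt_pos.2 (by positivity))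

theorem etaSchedule_mono {η₀ : ℝ} (hη₀ : 0 ≤ η₀) (K T : ℕ) : Monotone (etaSchedule η₀ K T) := by
  intro i j hij
  have hlog : 0 ≤ Real.log T := Real.log_natCast_nonneg T
  unfold etaSchedule
  gcongr

theorem etaSchedule_mul_horizon {η₀ : ℝ} {K T j : ℕ} (hT : 2 ≤ T) :
    etaSchedule η₀ K T j * T = η₀ * Real.sqrt ((K : ℝ) * j * T * Real.log T) := by
  have hT' : (0 : ℝ) < T := by positivity
  have h : (K : ℝ) * j * T * Real.log T = (j : ℝ) * K * Real.log T / T * (T : ℝ) ^ 2 := by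
    field_simp
  rw [h, Real.sqrt_mul' _ (by positivity), Real.sqrt_sq hT'.le, etaSchedule, mul_assoc]

/-! ### Bounds on the two regret contributions -/

namespace HTPSBandit

variable {K T U : ℕ} {v ε : ℝ} (B : HTPSBandit K T U v ε)

theorem gapMaxEpoch_nonneg (j : ℕ) : 0 ≤ B.gapMaxEpoch j :=
  Real.iSup_nonneg fun _ => abs_nonneg _

theorem gapMaxEpoch_le_gapMax {j : ℕ} (hj : j ∈ Finset.Icc 1 (U + 1)) :
    B.gapMaxEpoch j ≤ B.gapMax :=
  le_ciSup (f := fun j : Finset.Icc 1 (U + 1) => B.gapMaxEpoch j)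
    (Set.finite_range _).bddAbove ⟨j, hj⟩

theorem gapMax_nonneg : 0 ≤ B.gapMax :=
  Real.iSup_nonneg fun _ => B.gapMaxEpoch_nonneg _

theorem changeMin_le_changeMinAt {j : ℕ} (hj : j ∈ Finset.Icc 1 U) :
    B.changeMin ≤ B.changeMinAt j :=
  ciInf_le (f := fun j : Finset.Icc 1 U => B.changeMinAt j)
    (Set.finite_range _).bddBelow ⟨j, hj⟩

theorem changeMin_le_changeMinAround {j : ℕ} (hj : j ∈ Finset.Icc 1 U) :
    B.changeMin ≤ B.changeMinAround j := by
  have hj' := Finset.mem_Icc.1 hj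
  unfold changeMinAround
  split_ifs with h
  · exact B.changeMin_le_changeMinAt (h ▸ hj)
  · exact le_min (B.changeMin_le_changeMinAt (Finset.mem_Icc.2 (by omega)))
      (B.changeMin_le_changeMinAt hj)

/-- Telescoping. The subtraction is truncated, so each step needs `tc` monotone; the last one uses
`tc_le`, since the last epoch may be empty. -/
theorem sum_epochLength : ∑ j ∈ Finset.Icc 1 (U + 1), (B.epochLength j : ℝ) = T := by
  have key : ∀ n ≤ U + 1, ∑ j ∈ Finset.Icc 1 n, (B.epochLength j : ℝ) = B.tc n := by
    intro n
    induction n with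
    | zero => simp [B.tc_zero]
    | succ n ih =>
      intro hn
      have hle : B.tc n ≤ B.tc (n + 1) := by
        rcases Nat.lt_or_ge n U with h | h
        · exact (B.tc_lt n h).le
        · obtain rfl : n = U := by omega
          exact B.tc_last.symm ▸ B.tc_le
      rw [Finset.sum_Icc_succ_top (by omega), ih (by omega)]
      simp [epochLength, Nat.cast_sub hle]
  rw [key _ le_rfl, B.tc_last]

theorem epochOf_mem (t : ℕ) : B.epochOf t ∈ Finset.Icc 1 (U + 1) := by
  have h : ((Finset.Icc 1 U).filter (fun j => B.tc j < t)).card ≤ U := by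
    simpa using Finset.card_filter_le (Finset.Icc 1 U) (fun j => B.tc j < t)
  rw [Finset.mem_Icc, epochOf]
  omega

/-- Lets the realized parameters replace the schedule: they are only known to agree for detections
that occur. -/
theorem detectionDelayTerm_congr {η η' : ℕ → ℝ} (h : ∀ j ∈ Finset.Icc 1 U, η j = η' j) :
    B.detectionDelayTerm η = B.detectionDelayTerm η' :=
  Finset.sum_congr rfl fun j hj => by rw [h j hj]

theorem detectionDelayTerm_etaSchedule_le {η₀ : ℝ} (hK : 1 ≤ K) (hT : 2 ≤ T) (hv : 0 < v)
    (hε : 0 < ε) (hη₀ : 0 < η₀) (hδ : 0 < B.changeMin)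
    (hperiod : ∀ j ∈ Finset.Icc 1 (U + 1), 1 ≤ ⌊(K : ℝ) / etaSchedule η₀ K T j⌋₊) :
    B.detectionDelayTerm (etaSchedule η₀ K T) ≤
      4 * (v ^ (1 / ε) * Real.sqrt ((K : ℝ) * U * T * Real.log T) /
        (η₀ * B.changeMin ^ ((1 + ε) / ε)) * B.gapMax) := by
  have hlog : 0 < Real.log T := Real.log_pos (by exact_mod_cast hT)
  have hK' : (0 : ℝ) < K := by exact_mod_cast hK
  have hT' : (0 : ℝ) < T := by positivity
  have hG := B.gapMax_nonneg
  have hη := etaSchedule_pos hη₀ hK hT le_rfl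
  have hD : 0 < B.changeMin ^ ((1 + ε) / ε) := Real.rpow_pos_of_pos hδ _
  have hV : 0 < v ^ (1 / ε) := Real.rpow_pos_of_pos hv _
  have hterm : ∀ j ∈ Finset.Icc 1 U,
      v ^ (1 / ε) * Real.log T / B.changeMinAround j ^ ((1 + ε) / ε) *
        (⌈(K : ℝ) / etaSchedule η₀ K T j⌉ : ℝ) * B.gapMaxEpoch j ≤
      v ^ (1 / ε) * Real.log T / B.changeMin ^ ((1 + ε) / ε) *
        (2 * (K / etaSchedule η₀ K T 1)) * B.gapMax * (Real.sqrt j)⁻¹ := by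
    intro j hj
    have hj' := Finset.mem_Icc.1 hj
    have hjU : j ∈ Finset.Icc 1 (U + 1) := Finset.mem_Icc.2 (by omega)
    have h1 : (1 : ℝ) ≤ K / etaSchedule η₀ K T j :=
      Nat.one_le_floor_iff _ |>.1 (hperiod j hjU)
    -- `⌈x⌉ < x + 1 ≤ 2x` for `x ≥ 1`.
    have hceil : (⌈(K : ℝ) / etaSchedule η₀ K T j⌉ : ℝ) ≤
        2 * (K / etaSchedule η₀ K T j) := by
      linarith [Int.ceil_lt_add_one ((K : ℝ) / etaSchedule η₀ K T j)]
    have hceil0 : (0 : ℝ) ≤ (⌈(K : ℝ) / etaSchedule η₀ K T j⌉ : ℝ) :=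
      (zero_le_one.trans h1).trans (Int.le_ceil _)
    calc _ ≤ v ^ (1 / ε) * Real.log T / B.changeMin ^ ((1 + ε) / ε) *
          (2 * (K / etaSchedule η₀ K T j)) * B.gapMax := by
          have := B.gapMaxEpoch_nonneg j
          have := B.gapMaxEpoch_le_gapMax hjU
          have := B.changeMin_le_changeMinAround hj
          gcongr
      _ = _ := by
          rw [etaSchedule_eq η₀ K T j, ← div_div]
          simp only [div_eq_mul_inv]
          ring
  -- Cross-multiplied and scaled by `T`, this follows from `η_1 T = η₀ √(K T log T)`.
  have hKη : Real.log T * (K / etaSchedule η₀ K T 1) =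
      Real.sqrt ((K : ℝ) * T * Real.log T) / η₀ := by
    have h := etaSchedule_mul_horizon (η₀ := η₀) (K := K) (j := 1) hT
    have hs : Real.sqrt ((K : ℝ) * T * Real.log T) ^ 2 = K * T * Real.log T :=
      Real.sq_sqrt (by positivity)
    rw [Nat.cast_one, mul_one] at h
    rw [← mul_div_assoc, div_eq_div_iff hη.ne' hη₀.ne']
    apply mul_right_cancel₀ hT'.ne'
    linear_combination (-Real.sqrt ((K : ℝ) * T * Real.log T)) * h - η₀ * hs
  have hsqrt : Real.sqrt ((K : ℝ) * U * T * Real.log T) =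
      Real.sqrt ((K : ℝ) * T * Real.log T) * Real.sqrt U := by
    rw [← Real.sqrt_mul' _ (Nat.cast_nonneg U)]
    congr 1
    ring
  calc B.detectionDelayTerm (etaSchedule η₀ K T)
      ≤ ∑ j ∈ Finset.Icc 1 U, v ^ (1 / ε) * Real.log T / B.changeMin ^ ((1 + ε) / ε) *
        (2 * (K / etaSchedule η₀ K T 1)) * B.gapMax * (Real.sqrt j)⁻¹ := Finset.sum_le_sum hterm
    _ ≤ v ^ (1 / ε) * Real.log T / B.changeMin ^ ((1 + ε) / ε) *
        (2 * (K / etaSchedule η₀ K T 1)) * B.gapMax * (2 * Real.sqrt U) := by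
        rw [← Finset.mul_sum]
        gcongr
        exact sum_inv_sqrt_le U
    _ = 4 * v ^ (1 / ε) / B.changeMin ^ ((1 + ε) / ε) *
        (Real.log T * (K / etaSchedule η₀ K T 1)) * B.gapMax * Real.sqrt U := by ring
    _ = _ := by
        rw [hKη, hsqrt]
        field_simp

theorem explorationTerm_etaSchedule_le {η₀ : ℝ} (hT : 2 ≤ T) (hη₀ : 0 ≤ η₀) :
    B.explorationTerm (etaSchedule η₀ K T) ≤
      η₀ * Real.sqrt ((K : ℝ) * (U + 1) * T * Real.log T) * B.gapMax := by
  have h := etaSchedule_mul_horizon (η₀ := η₀) (K := K) (j := U + 1) hT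
  push_cast at h
  rw [← h, ← B.sum_epochLength, Finset.mul_sum, Finset.sum_mul]
  refine Finset.sum_le_sum fun j hj => ?_
  have h1 := B.gapMaxEpoch_nonneg j
  have h2 := B.gapMaxEpoch_le_gapMax hj
  have h3 := etaSchedule_mono hη₀ K T (Finset.mem_Icc.1 hj).2
  have h4 : 0 ≤ etaSchedule η₀ K T (U + 1) := mul_nonneg hη₀ (Real.sqrt_nonneg _)
  gcongr

theorem roundwiseExplorationTerm_le {η : ℕ → ℝ} {c : ℝ} (hc : 0 ≤ c)
    (hη : ∀ t ∈ Finset.Icc 1 T, η t ≤ c) :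
    B.roundwiseExplorationTerm η ≤ c * T * B.gapMax := by
  have hsum : ∑ _t ∈ Finset.Icc 1 T, c * B.gapMax = c * T * B.gapMax := by
    simp only [Finset.sum_const, Nat.card_Icc, Nat.add_sub_cancel, nsmul_eq_mul]
    ring
  rw [← hsum]
  exact Finset.sum_le_sum fun t ht =>
    mul_le_mul (hη t ht) (B.gapMaxEpoch_le_gapMax (B.epochOf_mem t)) (B.gapMaxEpoch_nonneg _) hc

end HTPSBandit

/-! ### The parameters used along a run -/

namespace RCPDUCB

variable {K : ℕ} (T : ℕ) (v ε : ℝ) (lam : ℕ → ℕ → ℝ) (η : ℕ → ℝ)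
  (πs : ℕ → List (Fin K × ℝ) → Fin K) (X : ℕ → Fin K → ℝ)

theorem detections_run_succ (t : ℕ) :
    (run T v ε lam η πs X (t + 1)).detections = (run T v ε lam η πs X t).detections ∨
      (run T v ε lam η πs X (t + 1)).detections = (run T v ε lam η πs X t).detections + 1 := by
  simp only [run, step]
  split_ifs
  · exact Or.inr rfl
  · exact Or.inl rfl

theorem detections_run_mono : Monotone fun t => (run T v ε lam η πs X t).detections :=
  monotone_nat_of_le_succ fun t => by
    have := detections_run_succ T v ε lam η πs X t
    omega

/-- The counter rises by at most one per round, so just before it first reaches `j` it equals `j -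
1`. The parameter in force is read from that earlier state, hence has index `j`. The hypothesis `ht`
excludes the default value of `sInf ∅`. -/
theorem etaAt_detectionTime {j t : ℕ} (hj : 1 ≤ j)
    (ht : j ≤ (run T v ε lam η πs X t).detections) :
    etaAt T v ε lam η πs X (detectionTime T v ε lam η πs X j) = η j := by
  have hmem : j ≤ (run T v ε lam η πs X (detectionTime T v ε lam η πs X j)).detections :=
    Nat.sInf_mem (s := {t | j ≤ (run T v ε lam η πs X t).detections}) ⟨t, ht⟩
  have hmin : ∀ s < detectionTime T v ε lam η πs X j,
      ¬ j ≤ (run T v ε lam η πs X s).detections := fun s hs =>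
    Nat.notMem_of_lt_sInf (s := {t | j ≤ (run T v ε lam η πs X t).detections}) hs
  unfold etaAt
  generalize detectionTime T v ε lam η πs X j = m at hmem hmin
  cases m with
  -- The counter starts at 0, so no detection `j ≥ 1` has time 0.
  | zero =>
    have : j ≤ 0 := hmem
    omega
  | succ m =>
    have h1 := hmin m (Nat.lt_succ_self m)
    have h2 := detections_run_succ T v ε lam η πs X m
    rw [Nat.add_sub_cancel]
    congr 1
    omega

end RCPDUCB

theorem corollary1 {K T U : ℕ} {v ε η₀ : ℝ} (hK : 1 ≤ K) (hT : 2 ≤ T) (hU : 1 ≤ U)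
    (hv : 0 < v) (hε0 : 0 < ε) (hε1 : ε ≤ 1) (hη₀ : 0 < η₀)
    (B : HTPSBandit K T U v ε) (hδ : 0 < B.changeMin)
    (hperiod : ∀ j ∈ Finset.Icc 1 (U + 1), 1 ≤ ⌊(K : ℝ) / etaSchedule η₀ K T j⌋₊) :
    (B.detectionDelayTerm (etaSchedule η₀ K T) ≤
        4 * (v ^ (1 / ε) * Real.sqrt ((K : ℝ) * U * T * Real.log T) /
          (η₀ * B.changeMin ^ ((1 + ε) / ε)) * B.gapMax) ∧
      B.explorationTerm (etaSchedule η₀ K T) ≤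
        η₀ * Real.sqrt ((K : ℝ) * (U + 1) * T * Real.log T) * B.gapMax) ∧
    ∀ (lam : ℕ → ℕ → ℝ) (πs : ℕ → List (Fin K × ℝ) → Fin K) (X : ℕ → Fin K → ℝ),
      (RCPDUCB.run T v ε lam (etaSchedule η₀ K T) πs X T).detections = U →
      B.detectionDelayTerm (fun j =>
          RCPDUCB.etaAt T v ε lam (etaSchedule η₀ K T) πs X
            (RCPDUCB.detectionTime T v ε lam (etaSchedule η₀ K T) πs X j)) ≤
        4 * (v ^ (1 / ε) * Real.sqrt ((K : ℝ) * U * T * Real.log T) /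
          (η₀ * B.changeMin ^ ((1 + ε) / ε)) * B.gapMax) ∧
      B.roundwiseExplorationTerm
          (RCPDUCB.etaAt T v ε lam (etaSchedule η₀ K T) πs X) ≤
        η₀ * Real.sqrt ((K : ℝ) * (U + 1) * T * Real.log T) * B.gapMax := by
  have hA := B.detectionDelayTerm_etaSchedule_le hK hT hv hε0 hη₀ hδ hperiod
  refine ⟨⟨hA, B.explorationTerm_etaSchedule_le hT hη₀.le⟩, fun lam πs X hrun => ⟨?_, ?_⟩⟩
  · rwa [B.detectionDelayTerm_congr (η' := etaSchedule η₀ K T)]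
    intro j hj
    have hj' := Finset.mem_Icc.1 hj
    exact RCPDUCB.etaAt_detectionTime T v ε lam _ πs X hj'.1 (hj'.2.trans hrun.ge)
  · have h := etaSchedule_mul_horizon (η₀ := η₀) (K := K) (j := U + 1) hT
    push_cast at h
    rw [← h]
    refine B.roundwiseExplorationTerm_le (mul_nonneg hη₀.le (Real.sqrt_nonneg _)) fun t ht => ?_
    have htT : t - 1 ≤ T := (Nat.sub_le t 1).trans (Finset.mem_Icc.1 ht).2
    have hdet := RCPDUCB.detections_run_mono T v ε lam (etaSchedule η₀ K T) πs X htT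
    -- At most `U` detections precede round `t`, so the index in force is at most `U + 1`.
    exact etaSchedule_mono hη₀.le K T (Nat.succ_le_succ (hdet.trans hrun.le))
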